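/- Let $r\in\mathbb N$ and let $0<\lambda_1<1<\lambda_2$ satisfy $\frac{\lambda_1^r+\lambda_2^r}{2}<1$; let $d_1,d_2\in\mathbb R$. For $\lambda>0$ with $\lambda\lambda_2<1$ let $\mu_{\lambda,\lambda_2}$ be the stationary measure of the iterated function system $f_1(x)=\lambda x+d_1$, $f_2(x)=\lambda_2x+d_2$ with probabilities $(\frac12,\frac12)$, i.e. the unique Borel probability measure $\mu$ on $\mathbb R$ with $\mu=\frac12(f_1)_*\mu+\frac12(f_2)_*\mu$. Let $\nu=(\frac12,\frac12)^{\mathbb N}$ be the Bernoulli measure on $\Sigma=\{1,2\}^{\mathbb N}$; for $i=(i_1,i_2,\dots)\in\Sigma$ put $\lambda_1(\epsilon)=\lambda_1+\epsilon$, $\lambda_2(\epsilon)=\lambda_2$, let $o(m)$ be the number of $1$'s among $i_1,\dots,i_m$, and define $$X(\epsilon)=\sum_{m=0}^\infty \lambda_{i_1}(\epsilon)\cdots\lambda_{i_m}(\epsilon)\,d_{i_{m+1}},\qquad X=X(0),\qquad X^{(j)}=\frac{j!}{\lambda_1^j}\sum_{m=1}^\infty \lambda_{i_1}\cdots\lambda_{i_m}\binom{o(m)}{j}d_{i_{m+1}}\quad(j\ge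 1).$$ Let $\phi\in C^r(\mathbb R)$ be real-valued with $\sup_{\mathbb R}|\phi^{(r)}|<\infty$. Then: (a) For all sufficiently small $|\epsilon|$ the stationary measure $\mu_{\lambda_1+\epsilon,\lambda_2}$ exists and is unique, and $\phi$ is integrable with respect to it. (b) For $\nu$-almost every $i$, the series $X(\epsilon)$ converges for all sufficiently small $|\epsilon|$; for every $j\ge1$ the series $X^{(j)}$ converges, $X(\epsilon)$ is $j$ times differentiable at $\epsilon=0$, and $X^{(j)}=\frac{d^j}{d\epsilon^j}X(\epsilon)|_{\epsilon=0}$; moreover $\epsilon\mapsto\phi(X(\epsilon))$ is $r$ times differentiable at $0$. (c) The function $h(\epsilon)=\int\phi\,d\mu_{\lambda_1+\epsilon,\lambda_2}$ is differentiable at $0$ up to order $r$, and for $l=1,\dots,r$ $$h^{(l)}(0)=\int_\Sigma\frac{d^l}{d\epsilon^l}\bigl(\phi(X(\epsilon))\bigr)\Big|_{\epsilon=0}\,d\nu=\int_\Sigma\ \sum_{k_1+2k_2+\cdots+lk_l=l}L(k_1,\dots,k_l)\,\phi^{(k_1+\cdots+k_l)}(X)\prod_{j=1}^{l}\bigl(X^{(j)}\bigr)^{k_j}\,d\nu,$$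 both integrands being $\nu$-integrable. Here the sum is over all tuples of non-negative integers $(k_1,\dots,k_l)$ with $k_1+2k_2+\cdots+lk_l=l$, and $L(k_1,\dots,k_l)=\dfrac{l!}{k_1!\,(1!)^{k_1}\cdots k_l!\,(l!)^{k_l}}$. -/

import Mathlib

open MeasureTheory Filter Topology
open scoped ENNReal Nat

/-- `μ` is a stationary measure of the probabilistic IFS `{x ↦ l₁ x + d₁, x ↦ l₂ x + d₂}` with
probabilities `(1/2, 1/2)`: a Borel probability measure with
`μ = (1/2) (f₁)_* μ + (1/2) (f₂)_* μ`. -/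
def IsStationaryMeasure (l₁ l₂ d₁ d₂ : ℝ) (μ : Measure ℝ) : Prop :=
  IsProbabilityMeasure μ ∧
    μ = (2⁻¹ : ℝ≥0∞) • μ.map (fun x => l₁ * x + d₁) + (2⁻¹ : ℝ≥0∞) • μ.map (fun x => l₂ * x + d₂)

open Classical in
/-- The stationary measure of the IFS (the zero measure if there is none). -/
noncomputable def stationaryMeasure (l₁ l₂ d₁ d₂ : ℝ) : Measure ℝ :=
  if h : ∃ μ : Measure ℝ, IsStationaryMeasure l₁ l₂ d₁ d₂ μ then h.choose else 0

/-- The Bernoulli measure `(1/2, 1/2)^ℕ` on the sequence space. The letters `1, 2` are written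
`0, 1 : Fin 2`, and the word `i₁ i₂ …` is `ω 0, ω 1, …`. -/
noncomputable def bernoulliMeasure : Measure (ℕ → Fin 2) :=
  Measure.infinitePi (fun _ : ℕ => (PMF.uniformOfFintype (Fin 2)).toMeasure)

/-- The product `l_{i₁} ⋯ l_{i_m}` along the word `ω`. -/
noncomputable def wordProd (l₁ l₂ : ℝ) (m : ℕ) (ω : ℕ → Fin 2) : ℝ :=
  ∏ s ∈ Finset.range m, (![l₁, l₂] : Fin 2 → ℝ) (ω s)

/-- The number of occurrences of the first letter among the first `m` letters of `ω`. -/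
def countFirst (m : ℕ) (ω : ℕ → Fin 2) : ℕ :=
  ((Finset.range m).filter (fun s => ω s = 0)).card

/-- The coding map `X = ∑_{m ≥ 0} l_{i₁} ⋯ l_{i_m} d_{i_{m+1}}`. -/
noncomputable def codingX (l₁ l₂ d₁ d₂ : ℝ) (ω : ℕ → Fin 2) : ℝ :=
  ∑' m : ℕ, wordProd l₁ l₂ m ω * (![d₁, d₂] : Fin 2 → ℝ) (ω m)

/-- The `m`-th term `l_{i₁} ⋯ l_{i_m} (o(m) choose j) d_{i_{m+1}}` of the series of `X^{(j)}`. -/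
noncomputable def formalTerm (l₁ l₂ d₁ d₂ : ℝ) (j m : ℕ) (ω : ℕ → Fin 2) : ℝ :=
  wordProd l₁ l₂ m ω * ((countFirst m ω).choose j : ℝ) * (![d₁, d₂] : Fin 2 → ℝ) (ω m)

/-- `X^{(j)} = (j! / l₁^j) ∑_{m ≥ 1} l_{i₁} ⋯ l_{i_m} (o(m) choose j) d_{i_{m+1}}`. -/
noncomputable def formalX (l₁ l₂ d₁ d₂ : ℝ) (j : ℕ) (ω : ℕ → Fin 2) : ℝ :=
  (j ! : ℝ) / l₁ ^ j * ∑' m : ℕ, formalTerm l₁ l₂ d₁ d₂ j (m + 1) ω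

/-- The tuples `(k₁, …, k_l)` of natural numbers with `k₁ + 2 k₂ + ⋯ + l k_l = l`; the entry
`k_j` is `k ⟨j - 1, _⟩`. (Each entry of such a tuple is at most `l`.) -/
def bruno (l : ℕ) : Finset (Fin l → ℕ) :=
  (Fintype.piFinset (fun _ : Fin l => Finset.range (l + 1))).filter
    (fun k => ∑ j : Fin l, ((j : ℕ) + 1) * k j = l)

/-- `L(k₁, …, k_l) = l! / (k₁! (1!)^{k₁} ⋯ k_l! (l!)^{k_l})`. -/
noncomputable def brunoCoeff (l : ℕ) (k : Fin l → ℕ) : ℝ :=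
  (l ! : ℝ) / ∏ j : Fin l, (((k j)! : ℝ) * (((j : ℕ) + 1)! : ℝ) ^ k j)

/-- The formal `l`-th derivative
`∑ L(k₁, …, k_l) φ^{(k₁ + ⋯ + k_l)}(X) ∏_{j=1}^l (X^{(j)})^{k_j}`. -/
noncomputable def formalDerivative (l₁ l₂ d₁ d₂ : ℝ) (phi : ℝ → ℝ) (l : ℕ) (ω : ℕ → Fin 2) : ℝ :=
  ∑ k ∈ bruno l, brunoCoeff l k * iteratedDeriv (∑ j : Fin l, k j) phi (codingX l₁ l₂ d₁ d₂ ω) *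
    ∏ j : Fin l, formalX l₁ l₂ d₁ d₂ ((j : ℕ) + 1) ω ^ k j

/-- `g` is differentiable at `a` up to order `r`: for each `n < r` the derivative `g^{(n)}` is
differentiable at `a`, and also at all points near `a` when `n < r - 1` (so that the derivatives
`g', …, g^{(r-1)}` exist near `a` and `g^{(r)}` exists at `a`). -/
def DifferentiableUpToAt (r : ℕ) (g : ℝ → ℝ) (a : ℝ) : Prop :=
  ∀ n < r, DifferentiableAt ℝ (iteratedDeriv n g) a ∧
    (n + 1 < r → ∀ᶠ x in 𝓝 a, DifferentiableAt ℝ (iteratedDeriv n g) x)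
/-!
The stationary measure is the law of the coding map `X` under the Bernoulli measure: cutting off
the first letter shows that this law is stationary, and iterating the stationarity equation along
random words forces every stationary measure to be this law.

The `L^r` norm of the `m`-th word product is `((|l₁|^r + |l₂|^r) / 2)^{m/r}`, so by Minkowski's
inequality the sum of the absolute word products lies in `L^r`, also after `|l₁|` is replaced by a
slightly larger `b`. A derivative in `l₁` costs each word product only a polynomial factor in the
number of first letters, which the room between `|l₁|` and `b` absorbs. Hence almost surely `X` is
smooth in `l₁` near the given parameter, and each of its derivatives there is at most a constant
times the `L^r` function `S = ∑ |wordProd b l₂ m|`.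

As `phi^{(r)}` is bounded, `phi^{(k)}` grows at most like `(1 + |x|)^{r - k}`. In a summand of Faà
di Bruno's formula for `(phi ∘ X)^{(n)}` with `k` factors `X^{(j)}`, these factors contribute at
most a multiple of `(1 + S)^k` and `phi^{(k)}(X)` at most a multiple of `(1 + S)^{r - k}`: the
summand is dominated by the integrable function `(1 + S)^r`. This is what allows differentiating
`r` times under the integral sign.
-/

section Smoothness

variable {𝕜 F : Type*} [NontriviallyNormedField 𝕜] [NormedAddCommGroup F] [NormedSpace 𝕜 F]

theorem iteratedDeriv_eqOn_of_hasDerivAt {s : Set 𝕜} (hs : IsOpen s) {r : ℕ∞} {G : ℕ → 𝕜 → F}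
    (hG : ∀ n : ℕ, n < r → ∀ x ∈ s, HasDerivAt (G n) (G (n + 1) x) x) {n : ℕ} (hn : n ≤ r) :
    Set.EqOn (iteratedDeriv n (G 0)) (G n) s := by
  induction n with
  | zero => simp [Set.eqOn_refl]
  | succ n ih =>
    have hn' : (n : ℕ∞) < r := lt_of_lt_of_le (by exact_mod_cast n.lt_succ_self) hn
    intro x hx
    rw [iteratedDeriv_succ, ((ih hn'.le).eventuallyEq_of_mem (hs.mem_nhds hx)).deriv_eq,
      (hG n hn' x hx).deriv]

theorem contDiffOn_of_hasDerivAt {s : Set 𝕜} (hs : IsOpen s) {r : ℕ∞} {G : ℕ → 𝕜 → F}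
    (hG : ∀ n : ℕ, n < r → ∀ x ∈ s, HasDerivAt (G n) (G (n + 1) x) x)
    (hcont : ∀ n : ℕ, n ≤ r → ContinuousOn (G n) s) : ContDiffOn 𝕜 r (G 0) s := by
  have hEq : ∀ n : ℕ, n ≤ r → Set.EqOn (iteratedDerivWithin n (G 0) s) (G n) s := fun n hn =>
    (iteratedDerivWithin_of_isOpen hs).trans (iteratedDeriv_eqOn_of_hasDerivAt hs hG hn)
  refine contDiffOn_of_continuousOn_differentiableOn_deriv
    (fun n hn => (hcont n hn).congr (hEq n hn)) fun n hn => ?_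
  exact DifferentiableOn.congr
    (fun x hx => (hG n hn x hx).differentiableAt.differentiableWithinAt) (hEq n hn.le)

theorem hasDerivAt_iteratedDeriv_of_contDiffAt {r : WithTop ℕ∞} {g : 𝕜 → F} {x : 𝕜}
    (hg : ContDiffAt 𝕜 r g x) {n : ℕ} (hn : n < r) :
    HasDerivAt (iteratedDeriv n g) (iteratedDeriv (n + 1) g x) x := by
  have h := ContDiffWithinAt.differentiableWithinAt_iteratedDerivWithin
    (s := Set.univ) hg.contDiffWithinAt hn (by simp [uniqueDiffOn_univ])
  rw [iteratedDerivWithin_univ, differentiableWithinAt_univ] at h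
  rw [iteratedDeriv_succ]
  exact h.hasDerivAt

theorem continuousOn_iteratedDeriv_of_isOpen {s : Set 𝕜} (hs : IsOpen s) {r : WithTop ℕ∞}
    {g : 𝕜 → F} (hg : ContDiffOn 𝕜 r g s) {n : ℕ} (hn : n ≤ r) :
    ContinuousOn (iteratedDeriv n g) s :=
  (hg.continuousOn_iteratedDerivWithin hn hs.uniqueDiffOn).congr
    (iteratedDerivWithin_of_isOpen hs).symm

theorem differentiableUpToAt_of_contDiffAt {r : ℕ} {g : ℝ → ℝ} {a : ℝ} (h : ContDiffAt ℝ r g a) :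
    DifferentiableUpToAt r g a := by
  intro n hn
  have hdiff : ∀ᶠ x in 𝓝 a, DifferentiableAt ℝ (iteratedDeriv n g) x := by
    filter_upwards [h.eventually (by simp)] with x hx
    exact (hasDerivAt_iteratedDeriv_of_contDiffAt hx (by exact_mod_cast hn)).differentiableAt
  exact ⟨hdiff.self_of_nhds, fun _ => hdiff⟩

end Smoothness

section DominatedDifferentiation

variable {F : Type*} [NormedAddCommGroup F] [NormedSpace ℝ F]

theorem contDiffOn_integral_of_dominated {Ω : Type*} [MeasurableSpace Ω] {μ : Measure Ω}
    {s : Set ℝ} (hs : IsOpen s) {r : ℕ∞} {f : ℝ → Ω → F} {B : ℕ → Ω → ℝ}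
    (hf : ∀ᵐ ω ∂μ, ContDiffOn ℝ r (f · ω) s)
    (hmeas : ∀ n : ℕ, n ≤ r → ∀ t ∈ s, AEStronglyMeasurable (fun ω => iteratedDeriv n (f · ω) t) μ)
    (hbound : ∀ n : ℕ, n ≤ r → ∀ᵐ ω ∂μ, ∀ t ∈ s, ‖iteratedDeriv n (f · ω) t‖ ≤ B n ω)
    (hB : ∀ n : ℕ, n ≤ r → Integrable (B n) μ) :
    ContDiffOn ℝ r (fun t => ∫ ω, f t ω ∂μ) s ∧ ∀ n : ℕ, n ≤ r →
      Set.EqOn (iteratedDeriv n fun t => ∫ ω, f t ω ∂μ)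
        (fun t => ∫ ω, iteratedDeriv n (f · ω) t ∂μ) s := by
  have hderiv : ∀ n : ℕ, n < r → ∀ t ∈ s,
      HasDerivAt (fun t => ∫ ω, iteratedDeriv n (f · ω) t ∂μ)
        (∫ ω, iteratedDeriv (n + 1) (f · ω) t ∂μ) t := by
    intro n hn t ht
    have hn' : ((n + 1 : ℕ) : ℕ∞) ≤ r := by exact_mod_cast Order.add_one_le_of_lt hn
    refine (hasDerivAt_integral_of_dominated_loc_of_deriv_le (hs.mem_nhds ht)
      (eventually_of_mem (hs.mem_nhds ht) (hmeas n hn.le))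
      ((hB n hn.le).mono' (hmeas n hn.le t ht) ((hbound n hn.le).mono fun ω h => h t ht))
      (hmeas (n + 1) hn' t ht) (hbound (n + 1) hn') (hB (n + 1) hn') ?_).2
    filter_upwards [hf] with ω hω x hx
    exact hasDerivAt_iteratedDeriv_of_contDiffAt (hω.contDiffAt (hs.mem_nhds hx))
      (by exact_mod_cast hn)
  have hcont : ∀ n : ℕ, n ≤ r →
      ContinuousOn (fun t => ∫ ω, iteratedDeriv n (f · ω) t ∂μ) s := fun n hn =>
    continuousOn_of_dominated (hmeas n hn) (fun t ht => (hbound n hn).mono fun ω h => h t ht)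
      (hB n hn) <| hf.mono fun ω hω =>
        continuousOn_iteratedDeriv_of_isOpen hs hω (by exact_mod_cast hn)
  have h0 : (fun t => ∫ ω, f t ω ∂μ) = fun t => ∫ ω, iteratedDeriv 0 (f · ω) t ∂μ := by
    simp only [iteratedDeriv_zero]
  rw [h0]
  exact ⟨contDiffOn_of_hasDerivAt hs hderiv hcont,
    fun n hn => iteratedDeriv_eqOn_of_hasDerivAt hs hderiv hn⟩

variable [CompleteSpace F]

theorem contDiffOn_tsum_of_norm_iteratedDeriv_le {ι : Type*} {s : Set ℝ} (hs : IsOpen s)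
    (hs' : IsPreconnected s) {r : ℕ∞} {f : ι → ℝ → F} {u : ℕ → ι → ℝ}
    (hf : ∀ i, ContDiffOn ℝ r (f i) s)
    (hbound : ∀ n : ℕ, n ≤ r → ∀ i, ∀ t ∈ s, ‖iteratedDeriv n (f i) t‖ ≤ u n i)
    (hu : ∀ n : ℕ, n ≤ r → Summable (u n)) :
    ContDiffOn ℝ r (fun t => ∑' i, f i t) s ∧ ∀ n : ℕ, n ≤ r →
      Set.EqOn (iteratedDeriv n fun t => ∑' i, f i t)
        (fun t => ∑' i, iteratedDeriv n (f i) t) s := by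
  have hderiv : ∀ n : ℕ, n < r → ∀ t ∈ s, HasDerivAt (fun t => ∑' i, iteratedDeriv n (f i) t)
      (∑' i, iteratedDeriv (n + 1) (f i) t) t := fun n hn t ht => by
    have hn' : ((n + 1 : ℕ) : ℕ∞) ≤ r := by exact_mod_cast Order.add_one_le_of_lt hn
    exact hasDerivAt_tsum_of_isPreconnected (hu (n + 1) hn') hs hs'
      (fun i x hx => hasDerivAt_iteratedDeriv_of_contDiffAt ((hf i).contDiffAt (hs.mem_nhds hx))
        (by exact_mod_cast hn)) (hbound (n + 1) hn') ht
      (.of_norm_bounded (hu n hn.le) fun i => hbound n hn.le i t ht) ht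
  have hcont : ∀ n : ℕ, n ≤ r → ContinuousOn (fun t => ∑' i, iteratedDeriv n (f i) t) s :=
    fun n hn => continuousOn_tsum (fun i => continuousOn_iteratedDeriv_of_isOpen hs (hf i)
      (by exact_mod_cast hn)) (hu n hn) (hbound n hn)
  have h0 : (fun t => ∑' i, f i t) = fun t => ∑' i, iteratedDeriv 0 (f i) t := by
    simp only [iteratedDeriv_zero]
  rw [h0]
  exact ⟨contDiffOn_of_hasDerivAt hs hderiv hcont,
    fun n hn => iteratedDeriv_eqOn_of_hasDerivAt hs hderiv hn⟩

end DominatedDifferentiation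

section FaaDiBruno

theorem mem_bruno {l : ℕ} {k : Fin l → ℕ} :
    k ∈ bruno l ↔ ∑ j : Fin l, ((j : ℕ) + 1) * k j = l := by
  rw [bruno, Finset.mem_filter, and_iff_right_iff_imp, Fintype.mem_piFinset]
  intro h j
  have hterm : ((j : ℕ) + 1) * k j ≤ l :=
    (Finset.single_le_sum (f := fun j : Fin l => ((j : ℕ) + 1) * k j)
      (fun _ _ => Nat.zero_le _) (Finset.mem_univ j)).trans h.le
  exact Finset.mem_range.2 (by nlinarith)

theorem sum_le_of_mem_bruno {l : ℕ} {k : Fin l → ℕ} (hk : k ∈ bruno l) : ∑ j, k j ≤ l :=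
  calc ∑ j, k j ≤ ∑ j : Fin l, ((j : ℕ) + 1) * k j :=
        Finset.sum_le_sum fun j _ => Nat.le_mul_of_pos_left _ j.val.succ_pos
    _ = l := mem_bruno.1 hk

open Polynomial in
theorem iteratedDeriv_polynomial_eval_zero (P : ℝ[X]) (n : ℕ) :
    iteratedDeriv n (fun x => P.eval x) 0 = (n ! : ℝ) * P.coeff n := by
  have h : ∀ x, iteratedDeriv n (fun x => P.eval x) x = (derivative^[n] P).eval x := by
    induction n with
    | zero => simp
    | succ n ih =>
      intro x
      rw [iteratedDeriv_succ, funext ih, Polynomial.deriv, Function.iterate_succ_apply']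
  rw [h, ← coeff_zero_eq_eval_zero, coeff_iterate_derivative, zero_add, Nat.descFactorial_self,
    nsmul_eq_mul]

open Polynomial in
/-- The polynomial `∑_{j=1}^l x_j t^j / j!` with prescribed derivatives `x₁, …, x_l` at `0` and no
constant term; `x_j` is `x j`. -/
noncomputable def taylorJet (l : ℕ) (x : ℕ → ℝ) : ℝ[X] :=
  ∑ j : Fin l, C (x (j + 1) / ((j : ℕ) + 1)!) * X ^ ((j : ℕ) + 1)

theorem taylorJet_coeff_zero (l : ℕ) (x : ℕ → ℝ) : (taylorJet l x).coeff 0 = 0 := by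
  simp [taylorJet, Polynomial.coeff_X_pow]

theorem taylorJet_coeff {l : ℕ} (x : ℕ → ℝ) {j : ℕ} (hj : 1 ≤ j) (hjl : j ≤ l) :
    (taylorJet l x).coeff j = x j / j ! := by
  obtain ⟨i, rfl⟩ := Nat.exists_eq_add_of_le' hj
  simp only [taylorJet, Polynomial.finsetSum_coeff, Polynomial.coeff_C_mul_X_pow]
  rw [Finset.sum_eq_single ⟨i, hjl⟩ (fun b _ hb => if_neg ?_) (by simp)]
  · simp
  · simpa [Fin.ext_iff, eq_comm] using hb

theorem taylorJet_pow_coeff (l p : ℕ) (x : ℕ → ℝ) :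
    (taylorJet l x ^ p).coeff l = ∑ k ∈ bruno l with ∑ j, k j = p,
      p ! * ∏ j : Fin l, x (j + 1) ^ k j / ((k j)! * (((j : ℕ) + 1)! : ℝ) ^ k j) := by
  have hexp : ∀ k : Fin l → ℕ, ((Nat.multinomial Finset.univ k : Polynomial ℝ) * ∏ j : Fin l,
      (Polynomial.C (x (j + 1) / ((j : ℕ) + 1)!) * Polynomial.X ^ ((j : ℕ) + 1)) ^ k j).coeff l =
      if l = ∑ j : Fin l, ((j : ℕ) + 1) * k j then (∑ j, k j)! *
        ∏ j : Fin l, x (j + 1) ^ k j / ((k j)! * (((j : ℕ) + 1)! : ℝ) ^ k j) else 0 := by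
    intro k
    simp only [mul_pow, Finset.prod_mul_distrib, ← pow_mul, Finset.prod_pow_eq_pow_sum,
      ← Polynomial.C_pow, ← map_prod, ← Polynomial.C_eq_natCast, ← mul_assoc, ← map_mul,
      Polynomial.coeff_C_mul_X_pow]
    congr 1
    rw [← Nat.multinomial_spec Finset.univ k]
    push_cast
    rw [mul_comm (∏ j, _) (Nat.multinomial _ _ : ℝ), mul_assoc, ← Finset.prod_mul_distrib]
    congr 1
    refine Finset.prod_congr rfl fun j _ => ?_
    rw [div_pow]
    field_simp
  rw [taylorJet, Finset.sum_pow_eq_sum_piAntidiag, Polynomial.finsetSum_coeff,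
    Finset.sum_congr rfl fun k _ => hexp k, ← Finset.sum_filter]
  refine Finset.sum_congr ?_ fun k hk => ?_
  · ext k
    simp [mem_bruno, and_comm, eq_comm]
  · rw [(Finset.mem_filter.1 hk).2]

theorem iteratedDeriv_comp_eq_of_jet_eq {n : ℕ} {f₁ f₂ g₁ g₂ : ℝ → ℝ} {x₁ x₂ : ℝ}
    (hg₁ : ContDiffAt ℝ n g₁ (f₁ x₁)) (hf₁ : ContDiffAt ℝ n f₁ x₁)
    (hg₂ : ContDiffAt ℝ n g₂ (f₂ x₂)) (hf₂ : ContDiffAt ℝ n f₂ x₂)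
    (hg : ∀ p ≤ n, iteratedDeriv p g₁ (f₁ x₁) = iteratedDeriv p g₂ (f₂ x₂))
    (hf : ∀ j, 1 ≤ j → j ≤ n → iteratedDeriv j f₁ x₁ = iteratedDeriv j f₂ x₂) :
    iteratedDeriv n (g₁ ∘ f₁) x₁ = iteratedDeriv n (g₂ ∘ f₂) x₂ := by
  rw [iteratedDeriv_comp_eq_sum_orderedFinpartition hg₁ hf₁ le_rfl,
    iteratedDeriv_comp_eq_sum_orderedFinpartition hg₂ hf₂ le_rfl]
  refine Finset.sum_congr rfl fun c _ => ?_
  rw [hg _ c.length_le, Finset.prod_congr rfl fun j _ => hf _ (c.partSize_pos j) (c.partSize_le j)]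

theorem iteratedDeriv_comp_eq_sum_bruno {l : ℕ} {g f : ℝ → ℝ} {x : ℝ}
    (hg : ContDiffAt ℝ l g (f x)) (hf : ContDiffAt ℝ l f x) :
    iteratedDeriv l (g ∘ f) x = ∑ k ∈ bruno l, brunoCoeff l k *
      iteratedDeriv (∑ j, k j) g (f x) * ∏ j : Fin l, iteratedDeriv (j + 1) f x ^ k j := by
  set a : ℕ → ℝ := fun p => iteratedDeriv p g (f x)
  set Q := taylorJet l fun j => iteratedDeriv j f x
  set R : Polynomial ℝ := ∑ p ∈ Finset.range (l + 1), Polynomial.C (a p / p !) * Polynomial.X ^ p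
  have hQ0 : Q.eval 0 = 0 := by
    rw [← Polynomial.coeff_zero_eq_eval_zero, taylorJet_coeff_zero]
  have hR : ∀ p ≤ l, R.coeff p = a p / p ! := fun p hp => by
    simp [R, Polynomial.coeff_X_pow, Nat.lt_succ_of_le hp]
  -- Both sides depend only on the jets of `g` and `f`, so these may be replaced by polynomials, for
  -- which the formula computes the coefficient of `X ^ l` in `R.comp Q`.
  have hjet : iteratedDeriv l (g ∘ f) x = iteratedDeriv l ((R.eval ·) ∘ (Q.eval ·)) 0 := by
    have hsmooth : ∀ (P : Polynomial ℝ) (y : ℝ), ContDiffAt ℝ l (P.eval ·) y := fun P y => by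
      simpa using (P.contDiff_aeval (𝕜 := ℝ) l).contDiffAt
    refine iteratedDeriv_comp_eq_of_jet_eq hg hf (hsmooth R _) (hsmooth Q _)
      (fun p hp => ?_) fun j hj hjl => ?_
    · rw [hQ0, iteratedDeriv_polynomial_eval_zero, hR p hp, mul_div_cancel₀ _ (by positivity)]
    · rw [iteratedDeriv_polynomial_eval_zero, taylorJet_coeff _ hj hjl,
        mul_div_cancel₀ _ (by positivity)]
  have hcomp : ((R.eval ·) ∘ (Q.eval ·) : ℝ → ℝ) = ((R.comp Q).eval ·) :=
    funext fun y => Polynomial.eval_comp.symm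
  rw [hjet, hcomp, iteratedDeriv_polynomial_eval_zero]
  simp only [Polynomial.comp, R, Polynomial.eval₂_finsetSum, Polynomial.eval₂_mul,
    Polynomial.eval₂_C, Polynomial.eval₂_X_pow, Polynomial.finsetSum_coeff, Polynomial.coeff_C_mul,
    Q, taylorJet_pow_coeff, Finset.mul_sum]
  rw [← Finset.sum_fiberwise_of_maps_to (g := fun k : Fin l → ℕ => ∑ j, k j)
    fun k hk => Finset.mem_range_succ_iff.2 (sum_le_of_mem_bruno hk)]
  refine Finset.sum_congr rfl fun p _ => Finset.sum_congr rfl fun k hk => ?_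
  rw [(Finset.mem_filter.1 hk).2, brunoCoeff, Finset.prod_div_distrib]
  simp only [a]
  field_simp

end FaaDiBruno

theorem abs_iteratedDeriv_comp_le {l r : ℕ} (hlr : l ≤ r) {g f : ℝ → ℝ} {x K Z : ℝ}
    (hg : ContDiffAt ℝ l g (f x)) (hf : ContDiffAt ℝ l f x)
    (hgK : ∀ p ≤ l, |iteratedDeriv p g (f x)| ≤ K * Z ^ (r - p))
    (hfZ : ∀ j, 1 ≤ j → j ≤ l → |iteratedDeriv j f x| ≤ Z) :
    |iteratedDeriv l (g ∘ f) x| ≤ Fintype.card (OrderedFinpartition l) * (K * Z ^ r) := by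
  have hterm : ∀ c : OrderedFinpartition l,
      |iteratedDeriv c.length g (f x) * ∏ j, iteratedDeriv (c.partSize j) f x| ≤ K * Z ^ r := by
    intro c
    have hprod : ∏ j, |iteratedDeriv (c.partSize j) f x| ≤ Z ^ c.length := by
      simpa using Finset.prod_le_prod (s := Finset.univ) (fun _ _ => abs_nonneg _)
        fun j _ => hfZ _ (c.partSize_pos j) (c.partSize_le j)
    calc |iteratedDeriv c.length g (f x) * ∏ j, iteratedDeriv (c.partSize j) f x|
        = |iteratedDeriv c.length g (f x)| * ∏ j, |iteratedDeriv (c.partSize j) f x| := by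
          rw [abs_mul, Finset.abs_prod]
      _ ≤ K * Z ^ (r - c.length) * Z ^ c.length :=
          mul_le_mul (hgK _ c.length_le) hprod (by positivity)
            ((abs_nonneg _).trans (hgK _ c.length_le))
      _ = K * Z ^ r := by rw [mul_assoc, ← pow_add, Nat.sub_add_cancel (c.length_le.trans hlr)]
  rw [iteratedDeriv_comp_eq_sum_orderedFinpartition hg hf le_rfl]
  refine (Finset.abs_sum_le_sum_abs _ _).trans ?_
  simpa [nsmul_eq_mul] using Finset.sum_le_card_nsmul Finset.univ _ _ fun c _ => hterm c

section Growth

variable {F : Type*} [NormedAddCommGroup F] [NormedSpace ℝ F]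

theorem norm_le_of_norm_deriv_le {f : ℝ → F} (hf : Differentiable ℝ f) {K : ℝ} (hK : 0 ≤ K) {p : ℕ}
    (h : ∀ x, ‖deriv f x‖ ≤ K * (1 + |x|) ^ p) (x : ℝ) :
    ‖f x‖ ≤ (‖f 0‖ + K) * (1 + |x|) ^ (p + 1) := by
  have hincr : ‖f x - f 0‖ ≤ K * (1 + |x|) ^ p * |x| := by
    have hle := (convex_closedBall (0 : ℝ) |x|).norm_image_sub_le_of_norm_deriv_le (𝕜 := ℝ)
      (C := K * (1 + |x|) ^ p) (fun y _ => hf y)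
      (fun y hy => (h y).trans ?_) (x := 0) (y := x) (by simp) (by simp)
    · simpa using hle
    · rw [mem_closedBall_zero_iff, Real.norm_eq_abs] at hy
      gcongr
  have hone : (1 : ℝ) ≤ (1 + |x|) ^ (p + 1) := one_le_pow₀ (by linarith [abs_nonneg x])
  calc ‖f x‖ ≤ ‖f 0‖ + ‖f x - f 0‖ := norm_le_norm_add_norm_sub' _ _
    _ ≤ ‖f 0‖ * (1 + |x|) ^ (p + 1) + K * (1 + |x|) ^ p * (1 + |x|) := by
        gcongr
        · exact le_mul_of_one_le_right (norm_nonneg _) hone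
        · exact hincr.trans (by gcongr; linarith)
    _ = (‖f 0‖ + K) * (1 + |x|) ^ (p + 1) := by ring

theorem exists_norm_iteratedDeriv_le {r : ℕ} {g : ℝ → F} (hg : ContDiff ℝ r g)
    (hb : ∃ M : ℝ, ∀ x, ‖iteratedDeriv r g x‖ ≤ M) :
    ∃ K : ℝ, 0 ≤ K ∧ ∀ k ≤ r, ∀ x, ‖iteratedDeriv k g x‖ ≤ K * (1 + |x|) ^ (r - k) := by
  have hexists : ∀ k ≤ r, ∃ K : ℝ, 0 ≤ K ∧
      ∀ x, ‖iteratedDeriv k g x‖ ≤ K * (1 + |x|) ^ (r - k) := by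
    intro k hk
    induction hk using Nat.decreasingInduction with
    | self =>
      obtain ⟨M, hM⟩ := hb
      exact ⟨M, (norm_nonneg _).trans (hM 0), by simpa using hM⟩
    | of_succ k hk ih =>
      obtain ⟨K, hK, hle⟩ := ih
      have hsub : r - k = r - (k + 1) + 1 := by lia
      rw [hsub]
      exact ⟨_, by positivity, norm_le_of_norm_deriv_le
        (hg.differentiable_iteratedDeriv k (by exact_mod_cast hk)) hK
        fun x => by rw [← iteratedDeriv_succ]; exact hle x⟩
  choose! K hK hle using hexists
  obtain ⟨K', hK'⟩ := ((Set.finite_Iic r).image K).bddAbove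
  refine ⟨K', (hK 0 r.zero_le).trans (hK' ⟨0, r.zero_le, rfl⟩), fun k hk x => (hle k hk x).trans ?_⟩
  gcongr
  exact hK' ⟨k, hk, rfl⟩

end Growth

section InfiniteProduct

theorem eq_infinitePi_of_forall_range {X : ℕ → Type*} [∀ i, MeasurableSpace (X i)]
    (μ : ∀ i, Measure (X i)) [∀ i, IsProbabilityMeasure (μ i)] {ν : Measure (∀ i, X i)}
    (hν : ∀ (n : ℕ) (t : ∀ i, Set (X i)), (∀ i, MeasurableSet (t i)) →
      ν ((Finset.range (n + 1) : Set ℕ).pi t) = ∏ i ∈ Finset.range (n + 1), μ i (t i)) :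
    ν = Measure.infinitePi μ := by
  classical
  refine Measure.eq_infinitePi μ fun s t ht => ?_
  obtain ⟨n, hn⟩ : ∃ n, s ⊆ Finset.range (n + 1) := ⟨_, s.subset_range_sup_succ⟩
  have hbox : (s : Set ℕ).pi t =
      (Finset.range (n + 1) : Set ℕ).pi (s.piecewise t fun _ => Set.univ) := by
    ext x
    simp only [Set.mem_pi, Finset.mem_coe]
    refine ⟨fun h i _ => ?_, fun h i hi => by simpa [hi] using h i (hn hi)⟩
    by_cases hi : i ∈ s <;> simp [hi, h]
  have ht' : ∀ i, MeasurableSet (s.piecewise t (fun _ => Set.univ) i) := fun i => by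
    by_cases hi : i ∈ s <;> simp [hi, ht i]
  rw [hbox, hν n _ ht', ← Finset.prod_subset hn (by simp +contextual)]
  exact Finset.prod_congr rfl fun i hi => by rw [Finset.piecewise_eq_of_mem _ _ _ hi]

variable {α : Type*}

/-- The word `a u₀ u₁ …` obtained from `u₀ u₁ …` by prepending the letter `a`. -/
def wordCons (a : α) (u : ℕ → α) : ℕ → α
  | 0 => a
  | n + 1 => u n

@[simp]
theorem wordCons_zero (a : α) (u : ℕ → α) : wordCons a u 0 = a := rfl

@[simp]
theorem wordCons_succ (a : α) (u : ℕ → α) (n : ℕ) : wordCons a u (n + 1) = u n := rfl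

theorem preimage_wordCons_pi_range (n : ℕ) (t : ℕ → Set α) :
    (fun p : α × (ℕ → α) => wordCons p.1 p.2) ⁻¹' (Finset.range (n + 1) : Set ℕ).pi t =
      t 0 ×ˢ (Finset.range n : Set ℕ).pi fun i => t (i + 1) := by
  ext p
  simp only [Finset.coe_range, Set.mem_preimage, Set.mem_pi, Set.mem_Iio, Set.mem_prod,
    Nat.forall_lt_succ_left, wordCons_zero, wordCons_succ]

variable [MeasurableSpace α]

theorem measurable_wordCons : Measurable fun p : α × (ℕ → α) => wordCons p.1 p.2 :=
  measurable_pi_lambda _ fun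
    | 0 => measurable_fst
    | n + 1 => (measurable_pi_apply n).comp measurable_snd

theorem map_wordCons_prod_infinitePi (μ : Measure α) [IsProbabilityMeasure μ] :
    (μ.prod (Measure.infinitePi fun _ : ℕ => μ)).map (fun p => wordCons p.1 p.2) =
      Measure.infinitePi fun _ : ℕ => μ := by
  refine eq_infinitePi_of_forall_range _ fun n t ht => ?_
  rw [Measure.map_apply measurable_wordCons (.pi (Finset.countable_toSet _) fun i _ => ht i),
    preimage_wordCons_pi_range, Measure.prod_prod,
    Measure.infinitePi_pi _ (fun i _ => ht (i + 1)), Finset.prod_range_succ', mul_comm]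

end InfiniteProduct

instance : IsProbabilityMeasure bernoulliMeasure := by
  unfold bernoulliMeasure
  infer_instance

theorem lintegral_bernoulliMeasure {f : (ℕ → Fin 2) → ℝ≥0∞} (hf : Measurable f) :
    ∫⁻ ω, f ω ∂bernoulliMeasure = 2⁻¹ * ∫⁻ ω, f (wordCons 0 ω) ∂bernoulliMeasure +
      2⁻¹ * ∫⁻ ω, f (wordCons 1 ω) ∂bernoulliMeasure := by
  have hsingle : ∀ i : Fin 2, (PMF.uniformOfFintype (Fin 2)).toMeasure {i} = 2⁻¹ := fun i => by
    rw [PMF.toMeasure_apply_singleton _ _ .of_discrete]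
    simp
  conv_lhs => rw [bernoulliMeasure, ← map_wordCons_prod_infinitePi]
  rw [lintegral_map hf measurable_wordCons, lintegral_prod (fun p => f (wordCons p.1 p.2))
    (hf.comp measurable_wordCons).aemeasurable,
    lintegral_fintype, Fin.sum_univ_two, hsingle, hsingle, mul_comm, mul_comm _ 2⁻¹]
  rfl

theorem memLp_tsum_norm_of_tsum_eLpNorm_ne_top {Ω ι E : Type*} [Countable ι]
    [NormedAddCommGroup E] {mΩ : MeasurableSpace Ω} {μ : Measure Ω} {p : ℝ≥0∞} (hp : 1 ≤ p)
    {f : ι → Ω → E} (hf : ∀ i, AEStronglyMeasurable (f i) μ)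
    (h : ∑' i, eLpNorm (f i) p μ ≠ ∞) : MemLp (fun ω => ∑' i, ‖f i ω‖) p μ := by
  have : Fact (1 ≤ p) := ⟨hp⟩
  have hmem : ∀ i, MemLp (fun ω => ‖f i ω‖) p μ := fun i =>
    MemLp.norm ⟨hf i, (ENNReal.le_tsum i).trans_lt h.lt_top⟩
  have hsum : ∑' i, ‖(hmem i).toLp‖ₑ ≠ ∞ := by simpa only [Lp.enorm_toLp, eLpNorm_norm] using h
  refine (Lp.memLp (∑' i, (hmem i).toLp)).ae_eq ?_
  filter_upwards [Lp.coeFn_tsum hsum, ae_all_iff.2 fun i => (hmem i).coeFn_toLp] with ω h₁ h₂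
  rw [h₁]
  exact tsum_congr h₂

section WordProd

theorem measurable_letter (c : Fin 2 → ℝ) (m : ℕ) : Measurable fun ω : ℕ → Fin 2 => c (ω m) :=
  (measurable_of_finite c).comp (measurable_pi_apply m)

theorem norm_letter_le (d₁ d₂ : ℝ) (i : Fin 2) :
    ‖(![d₁, d₂] : Fin 2 → ℝ) i‖ ≤ |d₁| + |d₂| := by
  fin_cases i <;> simp

variable (l₁ l₂ : ℝ) (m : ℕ)

theorem measurable_wordProd : Measurable (wordProd l₁ l₂ m) :=
  Finset.measurable_prod _ fun s _ => measurable_letter _ s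

theorem wordProd_zero (ω : ℕ → Fin 2) : wordProd l₁ l₂ 0 ω = 1 := Finset.prod_range_zero _

theorem wordProd_wordCons (i : Fin 2) (ω : ℕ → Fin 2) :
    wordProd l₁ l₂ (m + 1) (wordCons i ω) = (![l₁, l₂] : Fin 2 → ℝ) i * wordProd l₁ l₂ m ω :=
  (Finset.prod_range_succ' _ _).trans (mul_comm _ _)

theorem lintegral_enorm_wordProd_pow (r : ℕ) :
    ∫⁻ ω, ‖wordProd l₁ l₂ m ω‖ₑ ^ r ∂bernoulliMeasure =
      (2⁻¹ * ‖l₁‖ₑ ^ r + 2⁻¹ * ‖l₂‖ₑ ^ r) ^ m := by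
  have hmeas : ∀ m, Measurable fun ω => ‖wordProd l₁ l₂ m ω‖ₑ ^ r := fun m =>
    (measurable_wordProd l₁ l₂ m).enorm.pow_const r
  induction m with
  | zero => simp [wordProd_zero]
  | succ m ih =>
    rw [lintegral_bernoulliMeasure (hmeas _)]
    simp only [wordProd_wordCons, enorm_mul, mul_pow, Matrix.cons_val_zero, Matrix.cons_val_one]
    rw [lintegral_const_mul _ (hmeas m), lintegral_const_mul _ (hmeas m), ih]
    ring

theorem eLpNorm_wordProd {r : ℕ} (hr : r ≠ 0) :
    eLpNorm (wordProd l₁ l₂ m) r bernoulliMeasure =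
      ((2⁻¹ * ‖l₁‖ₑ ^ r + 2⁻¹ * ‖l₂‖ₑ ^ r) ^ (1 / (r : ℝ))) ^ m := by
  rw [eLpNorm_eq_lintegral_rpow_enorm_toReal (Nat.cast_ne_zero.2 hr) (ENNReal.natCast_ne_top r)]
  simp only [ENNReal.toReal_natCast, ENNReal.rpow_natCast]
  rw [lintegral_enorm_wordProd_pow, ← ENNReal.rpow_natCast_mul, ← ENNReal.rpow_mul_natCast,
    mul_comm (m : ℝ)]

variable {l₁ l₂ m}

theorem one_le_of_mean_abs_pow_lt_one {r : ℕ} (h : (|l₁| ^ r + |l₂| ^ r) / 2 < 1) : 1 ≤ r := by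
  refine Nat.one_le_iff_ne_zero.2 ?_
  rintro rfl
  norm_num at h

theorem tsum_eLpNorm_wordProd_ne_top {r : ℕ} (h : (|l₁| ^ r + |l₂| ^ r) / 2 < 1) :
    ∑' m, eLpNorm (wordProd l₁ l₂ m) r bernoulliMeasure ≠ ∞ := by
  have hmean : 2⁻¹ * ‖l₁‖ₑ ^ r + 2⁻¹ * ‖l₂‖ₑ ^ r =
      ENNReal.ofReal ((|l₁| ^ r + |l₂| ^ r) / 2) := by
    rw [ENNReal.ofReal_div_of_pos two_pos, ENNReal.ofReal_add (by positivity) (by positivity),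
      ENNReal.ofReal_pow (abs_nonneg _), ENNReal.ofReal_pow (abs_nonneg _),
      ← Real.enorm_eq_ofReal_abs, ← Real.enorm_eq_ofReal_abs, ENNReal.ofReal_ofNat,
      ENNReal.div_eq_inv_mul, mul_add]
  have hr := one_le_of_mean_abs_pow_lt_one h
  simp only [eLpNorm_wordProd l₁ l₂ _ (Nat.one_le_iff_ne_zero.1 hr)]
  rw [ENNReal.tsum_geometric, Ne, ENNReal.inv_eq_top, tsub_eq_zero_iff_le, not_le, hmean]
  exact ENNReal.rpow_lt_one (ENNReal.ofReal_lt_one.2 h) (by positivity)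

theorem ae_summable_abs_wordProd {r : ℕ} (h : (|l₁| ^ r + |l₂| ^ r) / 2 < 1) :
    ∀ᵐ ω ∂bernoulliMeasure, Summable fun m => |wordProd l₁ l₂ m ω| := by
  simpa only [Real.norm_eq_abs] using summable_norm_of_tsum_eLpNorm_ne_top
    (Nat.one_le_cast.2 (one_le_of_mean_abs_pow_lt_one h))
    (fun m => (measurable_wordProd l₁ l₂ m).aestronglyMeasurable) (tsum_eLpNorm_wordProd_ne_top h)

theorem memLp_tsum_abs_wordProd {r : ℕ} (h : (|l₁| ^ r + |l₂| ^ r) / 2 < 1) :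
    MemLp (fun ω => ∑' m, |wordProd l₁ l₂ m ω|) r bernoulliMeasure := by
  simpa only [Real.norm_eq_abs] using memLp_tsum_norm_of_tsum_eLpNorm_ne_top
    (Nat.one_le_cast.2 (one_le_of_mean_abs_pow_lt_one h))
    (fun m => (measurable_wordProd l₁ l₂ m).aestronglyMeasurable) (tsum_eLpNorm_wordProd_ne_top h)

end WordProd

section StationaryMeasure

variable {l₁ l₂ d₁ d₂ : ℝ}

theorem measurable_codingX (l₁ l₂ d₁ d₂ : ℝ) : Measurable (codingX l₁ l₂ d₁ d₂) :=
  Measurable.tsum fun _ => (measurable_wordProd _ _ _).mul (measurable_letter _ _)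

theorem summable_norm_wordProd_mul_letter (d₁ d₂ : ℝ) {ω : ℕ → Fin 2}
    (h : Summable fun m => |wordProd l₁ l₂ m ω|) :
    Summable fun m => ‖wordProd l₁ l₂ m ω * (![d₁, d₂] : Fin 2 → ℝ) (ω m)‖ := by
  refine .of_nonneg_of_le (fun _ => norm_nonneg _) (fun m => ?_) (h.mul_right (|d₁| + |d₂|))
  rw [norm_mul, Real.norm_eq_abs]
  exact mul_le_mul_of_nonneg_left (norm_letter_le _ _ _) (abs_nonneg _)

theorem codingX_wordCons (i : Fin 2) {ω : ℕ → Fin 2}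
    (h : Summable fun m => |wordProd l₁ l₂ m ω|) :
    codingX l₁ l₂ d₁ d₂ (wordCons i ω) =
      (![l₁, l₂] : Fin 2 → ℝ) i * codingX l₁ l₂ d₁ d₂ ω + (![d₁, d₂] : Fin 2 → ℝ) i := by
  have hs := (summable_norm_wordProd_mul_letter d₁ d₂ h).of_norm
  have hs' : Summable fun m => wordProd l₁ l₂ m (wordCons i ω) *
      (![d₁, d₂] : Fin 2 → ℝ) (wordCons i ω m) := by
    refine (summable_nat_add_iff 1).1 ?_
    simpa only [wordProd_wordCons, wordCons_succ, mul_assoc] using hs.mul_left _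
  rw [codingX, hs'.tsum_eq_zero_add, codingX, ← tsum_mul_left, add_comm]
  simp only [wordProd_zero, wordProd_wordCons, wordCons_zero, wordCons_succ, one_mul, mul_assoc]

/-- The value at `x` of the composition `f_{i₁} ∘ ⋯ ∘ f_{i_m}` of the maps of the IFS along the
word `ω`, in closed form. -/
noncomputable def wordMap (l₁ l₂ d₁ d₂ : ℝ) (m : ℕ) (ω : ℕ → Fin 2) (x : ℝ) : ℝ :=
  wordProd l₁ l₂ m ω * x +
    ∑ s ∈ Finset.range m, wordProd l₁ l₂ s ω * (![d₁, d₂] : Fin 2 → ℝ) (ω s)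

theorem wordMap_zero (ω : ℕ → Fin 2) (x : ℝ) : wordMap l₁ l₂ d₁ d₂ 0 ω x = x := by
  simp [wordMap, wordProd_zero]

theorem wordMap_wordCons (m : ℕ) (i : Fin 2) (ω : ℕ → Fin 2) (x : ℝ) :
    wordMap l₁ l₂ d₁ d₂ (m + 1) (wordCons i ω) x =
      (![l₁, l₂] : Fin 2 → ℝ) i * wordMap l₁ l₂ d₁ d₂ m ω x + (![d₁, d₂] : Fin 2 → ℝ) i := by
  simp only [wordMap, Finset.sum_range_succ', wordProd_wordCons, wordProd_zero, wordCons_zero,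
    wordCons_succ, mul_add, Finset.mul_sum, mul_assoc, one_mul, add_assoc]

theorem measurable_wordMap (l₁ l₂ d₁ d₂ : ℝ) (m : ℕ) :
    Measurable fun p : ℝ × (ℕ → Fin 2) => wordMap l₁ l₂ d₁ d₂ m p.2 p.1 :=
  (((measurable_wordProd l₁ l₂ m).comp measurable_snd).mul measurable_fst).add <|
    (Finset.measurable_fun_sum _ fun s _ =>
      (measurable_wordProd l₁ l₂ s).mul (measurable_letter _ s)).comp measurable_snd

theorem tendsto_wordMap_codingX {ω : ℕ → Fin 2} (h : Summable fun m => |wordProd l₁ l₂ m ω|)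
    (x : ℝ) :
    Tendsto (fun m => wordMap l₁ l₂ d₁ d₂ m ω x) atTop (𝓝 (codingX l₁ l₂ d₁ d₂ ω)) := by
  simpa only [wordMap, codingX, zero_mul, zero_add] using
    (h.of_abs.tendsto_atTop_zero.mul_const x).add
      (summable_norm_wordProd_mul_letter d₁ d₂ h).of_norm.hasSum.tendsto_sum_nat

theorem isStationaryMeasure_iff_lintegral {μ : Measure ℝ} [IsProbabilityMeasure μ] :
    IsStationaryMeasure l₁ l₂ d₁ d₂ μ ↔ ∀ f : ℝ → ℝ≥0∞, Measurable f →
      ∫⁻ x, f x ∂μ = 2⁻¹ * ∫⁻ x, f (l₁ * x + d₁) ∂μ + 2⁻¹ * ∫⁻ x, f (l₂ * x + d₂) ∂μ := by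
  have hrhs : ∀ f : ℝ → ℝ≥0∞, Measurable f →
      ∫⁻ x, f x ∂((2⁻¹ : ℝ≥0∞) • μ.map (fun x => l₁ * x + d₁) +
        (2⁻¹ : ℝ≥0∞) • μ.map (fun x => l₂ * x + d₂)) =
      2⁻¹ * ∫⁻ x, f (l₁ * x + d₁) ∂μ + 2⁻¹ * ∫⁻ x, f (l₂ * x + d₂) ∂μ := fun f hf => by
    rw [lintegral_add_measure, lintegral_smul_measure, lintegral_smul_measure,
      lintegral_map hf (by fun_prop), lintegral_map hf (by fun_prop), smul_eq_mul, smul_eq_mul]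
  refine ⟨fun h f hf => ?_, fun h => ⟨inferInstance, ?_⟩⟩
  · conv_lhs => rw [h.2]
    exact hrhs f hf
  · exact Measure.ext_of_lintegral _ fun f hf => (h f hf).trans (hrhs f hf).symm

theorem IsStationaryMeasure.map_wordMap {μ : Measure ℝ} (h : IsStationaryMeasure l₁ l₂ d₁ d₂ μ)
    (m : ℕ) :
    (μ.prod bernoulliMeasure).map (fun p => wordMap l₁ l₂ d₁ d₂ m p.2 p.1) = μ := by
  have := h.1
  have hm := measurable_wordMap l₁ l₂ d₁ d₂
  suffices hlint : ∀ f : ℝ → ℝ≥0∞, Measurable f →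
      ∫⁻ x, ∫⁻ ω, f (wordMap l₁ l₂ d₁ d₂ m ω x) ∂bernoulliMeasure ∂μ = ∫⁻ x, f x ∂μ by
    refine Measure.ext_of_lintegral _ fun f hf => ?_
    rw [lintegral_map hf (hm m), lintegral_prod (fun p => f (wordMap l₁ l₂ d₁ d₂ m p.2 p.1))
      (hf.comp (hm m)).aemeasurable, hlint f hf]
  induction m with
  | zero => simp [wordMap_zero]
  | succ m ih =>
    intro f hf
    have hf₁ : Measurable fun y => f (l₁ * y + d₁) := by fun_prop
    have hf₂ : Measurable fun y => f (l₂ * y + d₂) := by fun_prop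
    have hint : ∀ g : ℝ → ℝ≥0∞, Measurable g →
        Measurable fun x => ∫⁻ ω, g (wordMap l₁ l₂ d₁ d₂ m ω x) ∂bernoulliMeasure :=
      fun g hg => (hg.comp (hm m)).lintegral_prod_right'
    have hsplit : ∀ x, ∫⁻ ω, f (wordMap l₁ l₂ d₁ d₂ (m + 1) ω x) ∂bernoulliMeasure =
        2⁻¹ * ∫⁻ ω, f (l₁ * wordMap l₁ l₂ d₁ d₂ m ω x + d₁) ∂bernoulliMeasure +
          2⁻¹ * ∫⁻ ω, f (l₂ * wordMap l₁ l₂ d₁ d₂ m ω x + d₂) ∂bernoulliMeasure := fun x => by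
      rw [lintegral_bernoulliMeasure (f := fun ω => f (wordMap l₁ l₂ d₁ d₂ (m + 1) ω x))
        ((hf.comp (hm (m + 1))).comp measurable_prodMk_left)]
      simp only [wordMap_wordCons, Matrix.cons_val_zero, Matrix.cons_val_one]
    simp only [hsplit]
    rw [lintegral_add_left ((hint _ hf₁).const_mul _), lintegral_const_mul _ (hint _ hf₁),
      lintegral_const_mul _ (hint _ hf₂), ih _ hf₁, ih _ hf₂,
      ← isStationaryMeasure_iff_lintegral.1 h f hf]

theorem isStationaryMeasure_map_codingX (d₁ d₂ : ℝ)
    (h : ∀ᵐ ω ∂bernoulliMeasure, Summable fun m => |wordProd l₁ l₂ m ω|) :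
    IsStationaryMeasure l₁ l₂ d₁ d₂ (bernoulliMeasure.map (codingX l₁ l₂ d₁ d₂)) := by
  have hX := measurable_codingX l₁ l₂ d₁ d₂
  have := Measure.isProbabilityMeasure_map (μ := bernoulliMeasure) hX.aemeasurable
  refine isStationaryMeasure_iff_lintegral.2 fun f hf => ?_
  have hcons : ∀ i : Fin 2, ∫⁻ ω, f (codingX l₁ l₂ d₁ d₂ (wordCons i ω)) ∂bernoulliMeasure =
      ∫⁻ ω, f ((![l₁, l₂] : Fin 2 → ℝ) i * codingX l₁ l₂ d₁ d₂ ω + (![d₁, d₂] : Fin 2 → ℝ) i)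
        ∂bernoulliMeasure := fun i =>
    lintegral_congr_ae (h.mono fun ω hω => congrArg f (codingX_wordCons i hω))
  rw [lintegral_map hf hX, lintegral_map (by fun_prop) hX, lintegral_map (by fun_prop) hX,
    lintegral_bernoulliMeasure (f := fun ω => f (codingX l₁ l₂ d₁ d₂ ω)) (hf.comp hX),
    hcons, hcons]
  rfl

theorem IsStationaryMeasure.eq_map_codingX {μ : Measure ℝ}
    (hμ : IsStationaryMeasure l₁ l₂ d₁ d₂ μ)
    (h : ∀ᵐ ω ∂bernoulliMeasure, Summable fun m => |wordProd l₁ l₂ m ω|) :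
    μ = bernoulliMeasure.map (codingX l₁ l₂ d₁ d₂) := by
  have := hμ.1
  have hm : ∀ m, AEMeasurable (fun p : ℝ × (ℕ → Fin 2) => wordMap l₁ l₂ d₁ d₂ m p.2 p.1)
      (μ.prod bernoulliMeasure) := fun m => (measurable_wordMap l₁ l₂ d₁ d₂ m).aemeasurable
  have hX : Measurable (codingX l₁ l₂ d₁ d₂ ∘ Prod.snd (α := ℝ)) :=
    (measurable_codingX l₁ l₂ d₁ d₂).comp measurable_snd
  have hlaw : ∀ m, ProbabilityTheory.IdentDistrib (fun p => wordMap l₁ l₂ d₁ d₂ m p.2 p.1) id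
      (μ.prod bernoulliMeasure) μ := fun m =>
    ⟨hm m, aemeasurable_id, (hμ.map_wordMap m).trans Measure.map_id.symm⟩
  have hlim := tendstoInDistribution_of_ae_tendsto hm hX.aemeasurable <|
    (Measure.quasiMeasurePreserving_snd.ae h).mono fun p hp => tendsto_wordMap_codingX hp p.1
  have hconst := tendstoInDistribution_of_identDistrib (l := atTop)
    (X := fun m p => wordMap l₁ l₂ d₁ d₂ m p.2 p.1) (μ := fun _ => μ.prod bernoulliMeasure) 0
    (fun m => (hlaw 0).trans (hlaw m).symm) (hlaw 0)
  rw [← Measure.map_id (μ := μ), tendstoInDistribution_unique _ hconst hlim,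
    ← Measure.map_map (measurable_codingX _ _ _ _) measurable_snd, Measure.map_snd_prod,
    measure_univ, one_smul]

theorem existsUnique_isStationaryMeasure (d₁ d₂ : ℝ)
    (h : ∀ᵐ ω ∂bernoulliMeasure, Summable fun m => |wordProd l₁ l₂ m ω|) :
    ∃! μ : Measure ℝ, IsStationaryMeasure l₁ l₂ d₁ d₂ μ :=
  ⟨_, isStationaryMeasure_map_codingX d₁ d₂ h, fun _ hμ => hμ.eq_map_codingX h⟩

theorem stationaryMeasure_eq_map_codingX (d₁ d₂ : ℝ)
    (h : ∀ᵐ ω ∂bernoulliMeasure, Summable fun m => |wordProd l₁ l₂ m ω|) :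
    stationaryMeasure l₁ l₂ d₁ d₂ = bernoulliMeasure.map (codingX l₁ l₂ d₁ d₂) := by
  have hexists := (existsUnique_isStationaryMeasure d₁ d₂ h).exists
  rw [stationaryMeasure, dif_pos hexists]
  exact hexists.choose_spec.eq_map_codingX h

end StationaryMeasure

section FirstRatio

theorem wordProd_eq_pow_mul (t l₂ : ℝ) (m : ℕ) (ω : ℕ → Fin 2) :
    wordProd t l₂ m ω = t ^ countFirst m ω * wordProd 1 l₂ m ω := by
  have hletter : ∀ i : Fin 2, (![t, l₂] : Fin 2 → ℝ) i =
      (if i = 0 then t else 1) * (![1, l₂] : Fin 2 → ℝ) i := fun i => by fin_cases i <;> simp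
  simp only [wordProd, countFirst, hletter, Finset.prod_mul_distrib, Finset.prod_ite,
    Finset.prod_const, one_pow, mul_one]

theorem abs_wordProd_le_of_abs_le {t b : ℝ} (h : |t| ≤ |b|) (l₂ : ℝ) (m : ℕ) (ω : ℕ → Fin 2) :
    |wordProd t l₂ m ω| ≤ |wordProd b l₂ m ω| := by
  rw [wordProd_eq_pow_mul t, wordProd_eq_pow_mul b, abs_mul, abs_mul, abs_pow, abs_pow]
  gcongr

theorem measurable_countFirst (m : ℕ) : Measurable (countFirst m) := by
  unfold countFirst
  simp only [Finset.card_filter]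
  exact Finset.measurable_fun_sum _ fun s _ =>
    (measurable_of_finite fun i : Fin 2 => if i = 0 then 1 else 0).comp (measurable_pi_apply s)

theorem contDiff_wordProd (l₂ : ℝ) (m : ℕ) (ω : ℕ → Fin 2) {n : WithTop ℕ∞} :
    ContDiff ℝ n fun t => wordProd t l₂ m ω := by
  rw [funext fun t => wordProd_eq_pow_mul t l₂ m ω]
  fun_prop

theorem iteratedDeriv_wordProd (j : ℕ) (t l₂ : ℝ) (m : ℕ) (ω : ℕ → Fin 2) :
    iteratedDeriv j (fun t => wordProd t l₂ m ω) t =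
      (countFirst m ω).descFactorial j * t ^ (countFirst m ω - j) * wordProd 1 l₂ m ω := by
  rw [funext fun t => wordProd_eq_pow_mul t l₂ m ω, iteratedDeriv_mul_const_field,
    iteratedDeriv_pow]

theorem exists_descFactorial_mul_pow_le {a b : ℝ} (ha : 0 < a) (hab : a < b) (j : ℕ) :
    ∃ C : ℝ, 0 ≤ C ∧ ∀ n : ℕ, (n.descFactorial j : ℝ) * a ^ (n - j) ≤ C * b ^ n := by
  have hb : 0 < b := ha.trans hab
  have hq : |a / b| < 1 := by rwa [abs_of_pos (by positivity), div_lt_one hb]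
  obtain ⟨B, hB⟩ := (tendsto_pow_const_mul_const_pow_of_abs_lt_one j hq).bddAbove_range
  have hB' : ∀ n : ℕ, (n : ℝ) ^ j * (a / b) ^ n ≤ B := fun n => hB ⟨n, rfl⟩
  have hB0 : 0 ≤ B := le_trans (by positivity) (hB' 0)
  refine ⟨B / a ^ j, by positivity, fun n => ?_⟩
  rcases lt_or_ge n j with hn | hn
  · rw [Nat.descFactorial_of_lt hn, Nat.cast_zero, zero_mul]
    positivity
  · have hdesc : (n.descFactorial j : ℝ) ≤ (n : ℝ) ^ j := by
      exact_mod_cast Nat.descFactorial_le_pow n j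
    calc (n.descFactorial j : ℝ) * a ^ (n - j) ≤ (n : ℝ) ^ j * a ^ (n - j) := by gcongr
      _ = (n : ℝ) ^ j * (a / b) ^ n * (b ^ n / a ^ j) := by
        rw [pow_sub₀ _ ha.ne' hn, div_pow]
        field_simp
      _ ≤ B * (b ^ n / a ^ j) := by gcongr; exact hB' n
      _ = B / a ^ j * b ^ n := by ring

variable {a b l₂ : ℝ}

theorem exists_abs_iteratedDeriv_wordProd_le (ha : 0 < a) (hab : a < b) (l₂ : ℝ) (j : ℕ) :
    ∃ C : ℝ, 0 ≤ C ∧ ∀ t ∈ Metric.ball 0 a, ∀ m ω,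
      |iteratedDeriv j (fun t => wordProd t l₂ m ω) t| ≤ C * |wordProd b l₂ m ω| := by
  obtain ⟨C, hC0, hC⟩ := exists_descFactorial_mul_pow_le ha hab j
  refine ⟨C, hC0, fun t ht m ω => ?_⟩
  have hta : |t| ≤ a := (mem_ball_zero_iff.1 ht).le
  have hpow : (countFirst m ω).descFactorial j * |t| ^ (countFirst m ω - j) ≤
      C * b ^ countFirst m ω := le_trans (by gcongr) (hC _)
  rw [iteratedDeriv_wordProd, wordProd_eq_pow_mul b, abs_mul, abs_mul, abs_mul, abs_pow, abs_pow,
    Nat.abs_cast, abs_of_pos (ha.trans hab), ← mul_assoc]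
  exact mul_le_mul_of_nonneg_right hpow (abs_nonneg _)

theorem exists_norm_iteratedDeriv_wordProd_mul_letter_le (ha : 0 < a) (hab : a < b)
    (l₂ d₁ d₂ : ℝ) (j : ℕ) :
    ∃ C : ℝ, 0 ≤ C ∧ ∀ t ∈ Metric.ball 0 a, ∀ m ω,
      ‖iteratedDeriv j (fun t => wordProd t l₂ m ω * (![d₁, d₂] : Fin 2 → ℝ) (ω m)) t‖ ≤
        C * |wordProd b l₂ m ω| := by
  obtain ⟨C, hC0, hC⟩ := exists_abs_iteratedDeriv_wordProd_le ha hab l₂ j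
  refine ⟨C * (|d₁| + |d₂|), by positivity, fun t ht m ω => ?_⟩
  rw [iteratedDeriv_mul_const_field, norm_mul, mul_right_comm]
  exact mul_le_mul (hC t ht m ω) (norm_letter_le _ _ _) (norm_nonneg _) (by positivity)

theorem contDiffOn_codingX_and_eqOn_iteratedDeriv (ha : 0 < a) (hab : a < b) (d₁ d₂ : ℝ)
    {ω : ℕ → Fin 2} (h : Summable fun m => |wordProd b l₂ m ω|) :
    ContDiffOn ℝ (⊤ : ℕ∞) (fun t => codingX t l₂ d₁ d₂ ω) (Metric.ball 0 a) ∧ ∀ j : ℕ,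
      Set.EqOn (iteratedDeriv j fun t => codingX t l₂ d₁ d₂ ω) (fun t => ∑' m,
        iteratedDeriv j (fun t => wordProd t l₂ m ω * (![d₁, d₂] : Fin 2 → ℝ) (ω m)) t)
        (Metric.ball 0 a) := by
  choose C _ hC using exists_norm_iteratedDeriv_wordProd_mul_letter_le ha hab l₂ d₁ d₂
  obtain ⟨hsmooth, hderiv⟩ := contDiffOn_tsum_of_norm_iteratedDeriv_le (r := ⊤) Metric.isOpen_ball
    (convex_ball (0 : ℝ) a).isPreconnected
    (fun m => ((contDiff_wordProd l₂ m ω).mul contDiff_const).contDiffOn)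
    (fun j _ m t ht => hC j t ht m ω) (fun j _ => h.mul_left (C j))
  exact ⟨hsmooth, fun j => hderiv j le_top⟩

theorem contDiffOn_codingX (ha : 0 < a) (hab : a < b) (d₁ d₂ : ℝ) {ω : ℕ → Fin 2}
    (h : Summable fun m => |wordProd b l₂ m ω|) :
    ContDiffOn ℝ (⊤ : ℕ∞) (fun t => codingX t l₂ d₁ d₂ ω) (Metric.ball 0 a) :=
  (contDiffOn_codingX_and_eqOn_iteratedDeriv ha hab d₁ d₂ h).1

theorem iteratedDeriv_codingX (ha : 0 < a) (hab : a < b) (d₁ d₂ : ℝ) {ω : ℕ → Fin 2}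
    (h : Summable fun m => |wordProd b l₂ m ω|) {t : ℝ} (ht : t ∈ Metric.ball 0 a) {j : ℕ} :
    iteratedDeriv j (fun t => codingX t l₂ d₁ d₂ ω) t = ∑' m,
      iteratedDeriv j (fun t => wordProd t l₂ m ω * (![d₁, d₂] : Fin 2 → ℝ) (ω m)) t :=
  (contDiffOn_codingX_and_eqOn_iteratedDeriv ha hab d₁ d₂ h).2 j ht

end FirstRatio

section FormalDerivative

variable {a b l₂ t : ℝ} {ω : ℕ → Fin 2}

theorem iteratedDeriv_wordProd_mul_letter_eq_formalTerm (ht : t ≠ 0) (l₂ d₁ d₂ : ℝ) (j m : ℕ)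
    (ω : ℕ → Fin 2) :
    iteratedDeriv j (fun t => wordProd t l₂ m ω * (![d₁, d₂] : Fin 2 → ℝ) (ω m)) t =
      (j ! : ℝ) / t ^ j * formalTerm t l₂ d₁ d₂ j m ω := by
  rw [iteratedDeriv_mul_const_field, iteratedDeriv_wordProd, formalTerm, wordProd_eq_pow_mul t]
  rcases lt_or_ge (countFirst m ω) j with hlt | hge
  · simp [Nat.descFactorial_of_lt hlt, Nat.choose_eq_zero_of_lt hlt]
  · rw [Nat.descFactorial_eq_factorial_mul_choose, pow_sub₀ _ ht hge, Nat.cast_mul]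
    ring

theorem summable_formalTerm (ha : 0 < a) (hab : a < b) (d₁ d₂ : ℝ)
    (h : Summable fun m => |wordProd b l₂ m ω|) (ht : t ∈ Metric.ball 0 a) (ht0 : t ≠ 0) (j : ℕ) :
    Summable fun m => formalTerm t l₂ d₁ d₂ j m ω := by
  obtain ⟨C, -, hC⟩ := exists_norm_iteratedDeriv_wordProd_mul_letter_le ha hab l₂ d₁ d₂ j
  have hsum := Summable.of_norm_bounded (h.mul_left C) fun m => hC t ht m ω
  simp only [iteratedDeriv_wordProd_mul_letter_eq_formalTerm ht0] at hsum
  exact (summable_mul_left_iff (by positivity)).1 hsum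

theorem iteratedDeriv_codingX_eq_formalX (ha : 0 < a) (hab : a < b) (d₁ d₂ : ℝ)
    (h : Summable fun m => |wordProd b l₂ m ω|) (ht : t ∈ Metric.ball 0 a) (ht0 : t ≠ 0) {j : ℕ}
    (hj : 1 ≤ j) :
    iteratedDeriv j (fun t => codingX t l₂ d₁ d₂ ω) t = formalX t l₂ d₁ d₂ j ω := by
  have hzero : formalTerm t l₂ d₁ d₂ j 0 ω = 0 := by
    simp [formalTerm, countFirst, Nat.choose_eq_zero_of_lt hj]
  rw [iteratedDeriv_codingX ha hab d₁ d₂ h ht]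
  simp only [iteratedDeriv_wordProd_mul_letter_eq_formalTerm ht0]
  rw [tsum_mul_left, (summable_formalTerm ha hab d₁ d₂ h ht ht0 j).tsum_eq_zero_add, hzero,
    zero_add, formalX]

end FormalDerivative

section Domination

variable {a b l₂ t : ℝ} {r : ℕ} {phi : ℝ → ℝ}

theorem exists_abs_iteratedDeriv_codingX_le (ha : 0 < a) (hab : a < b) (l₂ d₁ d₂ : ℝ) (n : ℕ) :
    ∃ D : ℝ, 0 ≤ D ∧ ∀ j ≤ n, ∀ ω : ℕ → Fin 2, (Summable fun m => |wordProd b l₂ m ω|) →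
      ∀ t ∈ Metric.ball 0 a, |iteratedDeriv j (fun t => codingX t l₂ d₁ d₂ ω) t| ≤
        D * ∑' m, |wordProd b l₂ m ω| := by
  choose C hC0 hC using exists_norm_iteratedDeriv_wordProd_mul_letter_le ha hab l₂ d₁ d₂
  refine ⟨∑ j ∈ Finset.range (n + 1), C j, Finset.sum_nonneg fun j _ => hC0 j,
    fun j hj ω h t ht => ?_⟩
  have hCj : C j ≤ ∑ j ∈ Finset.range (n + 1), C j :=
    Finset.single_le_sum (fun j _ => hC0 j) (Finset.mem_range_succ_iff.2 hj)
  rw [iteratedDeriv_codingX ha hab d₁ d₂ h ht]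
  refine (tsum_of_norm_bounded (h.hasSum.mul_left (C j)) fun m => hC j t ht m ω).trans ?_
  gcongr

theorem aestronglyMeasurable_iteratedDeriv_codingX (ha : 0 < a) (hab : a < b) (d₁ d₂ : ℝ)
    (h : ∀ᵐ ω ∂bernoulliMeasure, Summable fun m => |wordProd b l₂ m ω|)
    (ht : t ∈ Metric.ball 0 a) (j : ℕ) :
    AEStronglyMeasurable (fun ω => iteratedDeriv j (fun t => codingX t l₂ d₁ d₂ ω) t)
      bernoulliMeasure := by
  have hmeas : Measurable fun ω => ∑' m,
      iteratedDeriv j (fun t => wordProd t l₂ m ω * (![d₁, d₂] : Fin 2 → ℝ) (ω m)) t := by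
    refine Measurable.tsum fun m => ?_
    simp only [iteratedDeriv_mul_const_field, iteratedDeriv_wordProd]
    exact ((((measurable_of_countable fun n : ℕ => (n.descFactorial j : ℝ) * t ^ (n - j)).comp
      (measurable_countFirst m))).mul (measurable_wordProd 1 l₂ m)).mul (measurable_letter _ m)
  refine hmeas.aestronglyMeasurable.congr ?_
  filter_upwards [h] with ω hω
  exact (iteratedDeriv_codingX ha hab d₁ d₂ hω ht).symm

theorem contDiffOn_comp_codingX (ha : 0 < a) (hab : a < b) (d₁ d₂ : ℝ) (hphi : ContDiff ℝ r phi)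
    {ω : ℕ → Fin 2} (h : Summable fun m => |wordProd b l₂ m ω|) :
    ContDiffOn ℝ r (fun t => phi (codingX t l₂ d₁ d₂ ω)) (Metric.ball 0 a) :=
  hphi.comp_contDiffOn ((contDiffOn_codingX ha hab d₁ d₂ h).of_le (mod_cast le_top))

theorem aestronglyMeasurable_iteratedDeriv_comp_codingX (ha : 0 < a) (hab : a < b) (d₁ d₂ : ℝ)
    (h : ∀ᵐ ω ∂bernoulliMeasure, Summable fun m => |wordProd b l₂ m ω|)
    (hphi : ContDiff ℝ r phi) {n : ℕ} (hn : n ≤ r) (ht : t ∈ Metric.ball 0 a) :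
    AEStronglyMeasurable (fun ω => iteratedDeriv n (fun t => phi (codingX t l₂ d₁ d₂ ω)) t)
      bernoulliMeasure := by
  have hmeas : AEStronglyMeasurable (fun ω => ∑ c : OrderedFinpartition n,
      iteratedDeriv c.length phi (codingX t l₂ d₁ d₂ ω) *
        ∏ i, iteratedDeriv (c.partSize i) (fun t => codingX t l₂ d₁ d₂ ω) t) bernoulliMeasure := by
    refine Finset.aestronglyMeasurable_fun_sum _ fun c _ => .mul ?_ ?_
    · exact (hphi.continuous_iteratedDeriv _ (mod_cast c.length_le.trans hn)).measurable.comp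
        (measurable_codingX t l₂ d₁ d₂) |>.aestronglyMeasurable
    · exact Finset.aestronglyMeasurable_fun_prod _ fun i _ =>
        aestronglyMeasurable_iteratedDeriv_codingX ha hab d₁ d₂ h ht _
  refine hmeas.congr ?_
  filter_upwards [h] with ω hω
  exact (iteratedDeriv_comp_eq_sum_orderedFinpartition (hphi.contDiffAt.of_le (mod_cast hn))
    (((contDiffOn_codingX ha hab d₁ d₂ hω).contDiffAt (Metric.isOpen_ball.mem_nhds ht)).of_le
      (mod_cast le_top)) le_rfl).symm

theorem exists_integrable_bound_iteratedDeriv_comp_codingX (ha : 0 < a) (hab : a < b) (d₁ d₂ : ℝ)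
    (hq : (|b| ^ r + |l₂| ^ r) / 2 < 1) (hphi : ContDiff ℝ r phi)
    (hb : ∃ M, ∀ x, |iteratedDeriv r phi x| ≤ M) {n : ℕ} (hn : n ≤ r) :
    ∃ B : (ℕ → Fin 2) → ℝ, Integrable B bernoulliMeasure ∧ ∀ᵐ ω ∂bernoulliMeasure,
      ∀ t ∈ Metric.ball 0 a, ‖iteratedDeriv n (fun t => phi (codingX t l₂ d₁ d₂ ω)) t‖ ≤ B ω := by
  obtain ⟨K, hK0, hK⟩ := exists_norm_iteratedDeriv_le hphi hb
  obtain ⟨D, hD0, hD⟩ := exists_abs_iteratedDeriv_codingX_le ha hab l₂ d₁ d₂ n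
  set S : (ℕ → Fin 2) → ℝ := fun ω => ∑' m, |wordProd b l₂ m ω|
  have hZ0 : ∀ ω, 0 ≤ 1 + D * S ω := fun ω =>
    add_nonneg zero_le_one (mul_nonneg hD0 (tsum_nonneg fun m => abs_nonneg _))
  have hS : MemLp S r bernoulliMeasure := memLp_tsum_abs_wordProd hq
  have hZ : MemLp (fun ω => 1 + D * S ω) r bernoulliMeasure :=
    (memLp_const (1 : ℝ)).add (hS.const_mul D)
  have hZr : Integrable (fun ω => (1 + D * S ω) ^ r) bernoulliMeasure := by
    simpa only [Real.norm_of_nonneg (hZ0 _)] using hZ.integrable_norm_pow'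
  refine ⟨fun ω => Fintype.card (OrderedFinpartition n) * (K * (1 + D * S ω) ^ r),
    (hZr.const_mul K).const_mul _, ?_⟩
  filter_upwards [ae_summable_abs_wordProd hq] with ω hω t ht
  have hX : |codingX t l₂ d₁ d₂ ω| ≤ D * S ω := by simpa using hD 0 n.zero_le ω hω t ht
  have hXdiff : ContDiffAt ℝ n (fun t => codingX t l₂ d₁ d₂ ω) t :=
    ((contDiffOn_codingX ha hab d₁ d₂ hω).contDiffAt (Metric.isOpen_ball.mem_nhds ht)).of_le
      (mod_cast le_top)
  refine abs_iteratedDeriv_comp_le (g := phi) (Z := 1 + D * S ω) hn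
    (hphi.contDiffAt.of_le (mod_cast hn)) hXdiff (fun p hp => (hK p (hp.trans hn) _).trans ?_)
    fun j _ hj => (hD j hj ω hω t ht).trans (by linarith)
  gcongr

end Domination

section Parameter

variable {l₁ l₂ : ℝ} {r : ℕ} {phi : ℝ → ℝ}

theorem eventually_mean_abs_pow_lt_one (h : (|l₁| ^ r + |l₂| ^ r) / 2 < 1) :
    ∀ᶠ t in 𝓝 l₁, (|t| ^ r + |l₂| ^ r) / 2 < 1 := by
  have hcont : ContinuousAt (fun t : ℝ => (|t| ^ r + |l₂| ^ r) / 2) l₁ := by fun_prop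
  exact hcont.eventually_lt_const h

theorem exists_radii_mean_abs_pow_lt_one (h : (|l₁| ^ r + |l₂| ^ r) / 2 < 1) :
    ∃ a b : ℝ, 0 < a ∧ a < b ∧ l₁ ∈ Metric.ball 0 a ∧ (|b| ^ r + |l₂| ^ r) / 2 < 1 := by
  rw [← abs_abs l₁] at h
  obtain ⟨b, hl₁b, hb⟩ := ((eventually_mem_nhdsWithin (s := Set.Ioi |l₁|)).and
    ((eventually_mean_abs_pow_lt_one h).filter_mono nhdsWithin_le_nhds)).exists
  obtain ⟨a, hl₁a, hab⟩ := exists_between (Set.mem_Ioi.1 hl₁b)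
  exact ⟨a, b, (abs_nonneg l₁).trans_lt hl₁a, hab, mem_ball_zero_iff.2 hl₁a, hb⟩

theorem ae_eventually_summable_abs_wordProd (h : (|l₁| ^ r + |l₂| ^ r) / 2 < 1) :
    ∀ᵐ ω ∂bernoulliMeasure, ∀ᶠ t in 𝓝 l₁, Summable fun m => |wordProd t l₂ m ω| := by
  obtain ⟨a, b, _, hab, hl₁, hq⟩ := exists_radii_mean_abs_pow_lt_one h
  filter_upwards [ae_summable_abs_wordProd hq] with ω hω
  filter_upwards [Metric.isOpen_ball.mem_nhds hl₁] with t ht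
  have htb : |t| ≤ |b| := ((mem_ball_zero_iff.1 ht).trans hab).le.trans (le_abs_self b)
  exact hω.of_nonneg_of_le (fun _ => abs_nonneg _) fun m => abs_wordProd_le_of_abs_le htb l₂ m ω

theorem ae_contDiffAt_codingX (d₁ d₂ : ℝ) (h : (|l₁| ^ r + |l₂| ^ r) / 2 < 1) :
    ∀ᵐ ω ∂bernoulliMeasure, ContDiffAt ℝ (⊤ : ℕ∞) (fun t => codingX t l₂ d₁ d₂ ω) l₁ := by
  obtain ⟨a, b, ha, hab, hl₁, hq⟩ := exists_radii_mean_abs_pow_lt_one h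
  filter_upwards [ae_summable_abs_wordProd hq] with ω hω
  exact (contDiffOn_codingX ha hab d₁ d₂ hω).contDiffAt (Metric.isOpen_ball.mem_nhds hl₁)

theorem ae_iteratedDeriv_codingX_eq_formalX (d₁ d₂ : ℝ) (hl₁ : l₁ ≠ 0)
    (h : (|l₁| ^ r + |l₂| ^ r) / 2 < 1) :
    ∀ᵐ ω ∂bernoulliMeasure, ∀ j, 1 ≤ j →
      Summable (fun m => formalTerm l₁ l₂ d₁ d₂ j m ω) ∧
        iteratedDeriv j (fun t => codingX t l₂ d₁ d₂ ω) l₁ = formalX l₁ l₂ d₁ d₂ j ω := by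
  obtain ⟨a, b, ha, hab, hmem, hq⟩ := exists_radii_mean_abs_pow_lt_one h
  filter_upwards [ae_summable_abs_wordProd hq] with ω hω j hj
  exact ⟨summable_formalTerm ha hab d₁ d₂ hω hmem hl₁ j,
    iteratedDeriv_codingX_eq_formalX ha hab d₁ d₂ hω hmem hl₁ hj⟩

theorem ae_iteratedDeriv_comp_codingX_eq_formalDerivative (d₁ d₂ : ℝ) (hl₁ : l₁ ≠ 0)
    (h : (|l₁| ^ r + |l₂| ^ r) / 2 < 1) (hphi : ContDiff ℝ r phi) :
    ∀ᵐ ω ∂bernoulliMeasure, ∀ n ≤ r, iteratedDeriv n (fun t => phi (codingX t l₂ d₁ d₂ ω)) l₁ =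
      formalDerivative l₁ l₂ d₁ d₂ phi n ω := by
  filter_upwards [ae_contDiffAt_codingX d₁ d₂ h, ae_iteratedDeriv_codingX_eq_formalX d₁ d₂ hl₁ h]
    with ω hX hderiv n hn
  refine (iteratedDeriv_comp_eq_sum_bruno (hphi.contDiffAt.of_le (mod_cast hn))
    (hX.of_le (mod_cast le_top))).trans ?_
  simp only [formalDerivative, (hderiv _ (Nat.le_add_left 1 _)).2]

theorem integrable_iteratedDeriv_comp_codingX (d₁ d₂ : ℝ) (h : (|l₁| ^ r + |l₂| ^ r) / 2 < 1)
    (hphi : ContDiff ℝ r phi) (hb : ∃ M, ∀ x, |iteratedDeriv r phi x| ≤ M) {n : ℕ} (hn : n ≤ r) :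
    Integrable (fun ω => iteratedDeriv n (fun t => phi (codingX t l₂ d₁ d₂ ω)) l₁)
      bernoulliMeasure := by
  obtain ⟨a, b, ha, hab, hl₁, hq⟩ := exists_radii_mean_abs_pow_lt_one h
  obtain ⟨B, hBint, hB⟩ :=
    exists_integrable_bound_iteratedDeriv_comp_codingX ha hab d₁ d₂ hq hphi hb hn
  exact hBint.mono' (aestronglyMeasurable_iteratedDeriv_comp_codingX ha hab d₁ d₂
    (ae_summable_abs_wordProd hq) hphi hn hl₁) (hB.mono fun ω hω => hω l₁ hl₁)

theorem integrable_stationaryMeasure (d₁ d₂ : ℝ) (h : (|l₁| ^ r + |l₂| ^ r) / 2 < 1)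
    (hphi : ContDiff ℝ r phi) (hb : ∃ M, ∀ x, |iteratedDeriv r phi x| ≤ M) :
    Integrable phi (stationaryMeasure l₁ l₂ d₁ d₂) := by
  rw [stationaryMeasure_eq_map_codingX d₁ d₂ (ae_summable_abs_wordProd h),
    integrable_map_measure hphi.continuous.aestronglyMeasurable
      (measurable_codingX l₁ l₂ d₁ d₂).aemeasurable]
  simpa only [iteratedDeriv_zero, Function.comp_def] using
    integrable_iteratedDeriv_comp_codingX d₁ d₂ h hphi hb r.zero_le

theorem integral_stationaryMeasure (d₁ d₂ : ℝ) (h : (|l₁| ^ r + |l₂| ^ r) / 2 < 1)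
    (hphi : Continuous phi) :
    ∫ x, phi x ∂stationaryMeasure l₁ l₂ d₁ d₂ =
      ∫ ω, phi (codingX l₁ l₂ d₁ d₂ ω) ∂bernoulliMeasure := by
  rw [stationaryMeasure_eq_map_codingX d₁ d₂ (ae_summable_abs_wordProd h),
    integral_map (measurable_codingX l₁ l₂ d₁ d₂).aemeasurable hphi.aestronglyMeasurable]

theorem contDiffAt_integral_comp_codingX_and_iteratedDeriv (d₁ d₂ : ℝ)
    (h : (|l₁| ^ r + |l₂| ^ r) / 2 < 1) (hphi : ContDiff ℝ r phi)
    (hb : ∃ M, ∀ x, |iteratedDeriv r phi x| ≤ M) :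
    ContDiffAt ℝ r (fun t => ∫ ω, phi (codingX t l₂ d₁ d₂ ω) ∂bernoulliMeasure) l₁ ∧
      ∀ n ≤ r, iteratedDeriv n
        (fun t => ∫ ω, phi (codingX t l₂ d₁ d₂ ω) ∂bernoulliMeasure) l₁ =
          ∫ ω, iteratedDeriv n (fun t => phi (codingX t l₂ d₁ d₂ ω)) l₁ ∂bernoulliMeasure := by
  obtain ⟨a, b, ha, hab, hl₁, hq⟩ := exists_radii_mean_abs_pow_lt_one h
  have hsum := ae_summable_abs_wordProd hq
  choose! B hBint hB using fun n (hn : n ≤ r) =>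
    exists_integrable_bound_iteratedDeriv_comp_codingX ha hab d₁ d₂ hq hphi hb hn
  obtain ⟨hsmooth, hderiv⟩ := contDiffOn_integral_of_dominated (μ := bernoulliMeasure) (r := r)
    (B := B) Metric.isOpen_ball
    (hsum.mono fun ω hω => contDiffOn_comp_codingX ha hab d₁ d₂ hphi hω)
    (fun n hn t ht => aestronglyMeasurable_iteratedDeriv_comp_codingX ha hab d₁ d₂ hsum hphi
      (mod_cast hn) ht) (fun n hn => hB n (mod_cast hn)) fun n hn => hBint n (mod_cast hn)
  exact ⟨hsmooth.contDiffAt (Metric.isOpen_ball.mem_nhds hl₁),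
    fun n hn => hderiv n (mod_cast hn) hl₁⟩

theorem integral_stationaryMeasure_eventuallyEq (d₁ d₂ : ℝ)
    (h : (|l₁| ^ r + |l₂| ^ r) / 2 < 1) (hphi : Continuous phi) :
    (fun t => ∫ x, phi x ∂stationaryMeasure t l₂ d₁ d₂) =ᶠ[𝓝 l₁]
      fun t => ∫ ω, phi (codingX t l₂ d₁ d₂ ω) ∂bernoulliMeasure :=
  (eventually_mean_abs_pow_lt_one h).mono fun _ ht => integral_stationaryMeasure d₁ d₂ ht hphi

theorem contDiffAt_integral_stationaryMeasure (d₁ d₂ : ℝ) (h : (|l₁| ^ r + |l₂| ^ r) / 2 < 1)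
    (hphi : ContDiff ℝ r phi) (hb : ∃ M, ∀ x, |iteratedDeriv r phi x| ≤ M) :
    ContDiffAt ℝ r (fun t => ∫ x, phi x ∂stationaryMeasure t l₂ d₁ d₂) l₁ :=
  (contDiffAt_integral_comp_codingX_and_iteratedDeriv d₁ d₂ h hphi hb).1.congr_of_eventuallyEq
    (integral_stationaryMeasure_eventuallyEq d₁ d₂ h hphi.continuous)

theorem iteratedDeriv_integral_stationaryMeasure (d₁ d₂ : ℝ)
    (h : (|l₁| ^ r + |l₂| ^ r) / 2 < 1) (hphi : ContDiff ℝ r phi)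
    (hb : ∃ M, ∀ x, |iteratedDeriv r phi x| ≤ M) {n : ℕ} (hn : n ≤ r) :
    iteratedDeriv n (fun t => ∫ x, phi x ∂stationaryMeasure t l₂ d₁ d₂) l₁ =
      ∫ ω, iteratedDeriv n (fun t => phi (codingX t l₂ d₁ d₂ ω)) l₁ ∂bernoulliMeasure :=
  ((integral_stationaryMeasure_eventuallyEq d₁ d₂ h hphi.continuous).iteratedDeriv_eq n).trans
    ((contDiffAt_integral_comp_codingX_and_iteratedDeriv d₁ d₂ h hphi hb).2 n hn)

end Parameter

theorem differentiableUpToAt_comp_const_add {r : ℕ} {g : ℝ → ℝ} {a : ℝ} (h : ContDiffAt ℝ r g a) :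
    DifferentiableUpToAt r (fun ε => g (a + ε)) 0 := by
  refine differentiableUpToAt_of_contDiffAt (ContDiffAt.comp 0 ?_ (by fun_prop))
  rwa [add_zero]

theorem iteratedDeriv_comp_const_add_zero (n : ℕ) (g : ℝ → ℝ) (a : ℝ) :
    iteratedDeriv n (fun ε => g (a + ε)) 0 = iteratedDeriv n g a := by
  simp only [iteratedDeriv_comp_const_add, add_zero]

theorem mainTheorem2_general (r : ℕ) (l₁ l₂ d₁ d₂ : ℝ) (hl₁ : l₁ ≠ 0)
    (hr : (|l₁| ^ r + |l₂| ^ r) / 2 < 1) (phi : ℝ → ℝ) (hphi : ContDiff ℝ (r : ℕ∞) phi)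
    (hb : ∃ M : ℝ, ∀ x, |iteratedDeriv r phi x| ≤ M) :
    (∀ᶠ ε in 𝓝 (0 : ℝ), (∃! μ : Measure ℝ, IsStationaryMeasure (l₁ + ε) l₂ d₁ d₂ μ) ∧
      Integrable phi (stationaryMeasure (l₁ + ε) l₂ d₁ d₂)) ∧
    (∀ᵐ ω ∂bernoulliMeasure,
      (∀ᶠ ε in 𝓝 (0 : ℝ),
        Summable (fun m => wordProd (l₁ + ε) l₂ m ω * (![d₁, d₂] : Fin 2 → ℝ) (ω m))) ∧
      (∀ j : ℕ, 1 ≤ j →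
        Summable (fun m => formalTerm l₁ l₂ d₁ d₂ j (m + 1) ω) ∧
        DifferentiableUpToAt j (fun ε => codingX (l₁ + ε) l₂ d₁ d₂ ω) 0 ∧
        iteratedDeriv j (fun ε => codingX (l₁ + ε) l₂ d₁ d₂ ω) 0 = formalX l₁ l₂ d₁ d₂ j ω) ∧
      DifferentiableUpToAt r (fun ε => phi (codingX (l₁ + ε) l₂ d₁ d₂ ω)) 0) ∧
    DifferentiableUpToAt r (fun ε => ∫ x, phi x ∂(stationaryMeasure (l₁ + ε) l₂ d₁ d₂)) 0 ∧
    ∀ l : ℕ, 1 ≤ l → l ≤ r →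
      Integrable (fun ω => iteratedDeriv l (fun ε => phi (codingX (l₁ + ε) l₂ d₁ d₂ ω)) 0)
        bernoulliMeasure ∧
      Integrable (fun ω => formalDerivative l₁ l₂ d₁ d₂ phi l ω) bernoulliMeasure ∧
      iteratedDeriv l (fun ε => ∫ x, phi x ∂(stationaryMeasure (l₁ + ε) l₂ d₁ d₂)) 0 =
        ∫ ω, iteratedDeriv l (fun ε => phi (codingX (l₁ + ε) l₂ d₁ d₂ ω)) 0 ∂bernoulliMeasure ∧
      iteratedDeriv l (fun ε => ∫ x, phi x ∂(stationaryMeasure (l₁ + ε) l₂ d₁ d₂)) 0 =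
        ∫ ω, formalDerivative l₁ l₂ d₁ d₂ phi l ω ∂bernoulliMeasure := by
  have hshift : Tendsto (fun ε : ℝ => l₁ + ε) (𝓝 0) (𝓝 l₁) := by
    simpa using (continuous_const_add l₁).tendsto 0
  have hX : ∀ n ω, iteratedDeriv n (fun ε => codingX (l₁ + ε) l₂ d₁ d₂ ω) 0 =
      iteratedDeriv n (fun t => codingX t l₂ d₁ d₂ ω) l₁ := fun n ω =>
    iteratedDeriv_comp_const_add_zero n (fun t => codingX t l₂ d₁ d₂ ω) l₁
  have hphiX : ∀ n ω, iteratedDeriv n (fun ε => phi (codingX (l₁ + ε) l₂ d₁ d₂ ω)) 0 =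
      iteratedDeriv n (fun t => phi (codingX t l₂ d₁ d₂ ω)) l₁ := fun n ω =>
    iteratedDeriv_comp_const_add_zero n (fun t => phi (codingX t l₂ d₁ d₂ ω)) l₁
  simp only [hX, hphiX, iteratedDeriv_comp_const_add_zero _
    (fun t => ∫ x, phi x ∂stationaryMeasure t l₂ d₁ d₂)]
  refine ⟨?_, ?_, differentiableUpToAt_comp_const_add
    (contDiffAt_integral_stationaryMeasure d₁ d₂ hr hphi hb), fun l _ hl => ?_⟩
  · filter_upwards [hshift.eventually (eventually_mean_abs_pow_lt_one hr)] with ε hε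
    exact ⟨existsUnique_isStationaryMeasure d₁ d₂ (ae_summable_abs_wordProd hε),
      integrable_stationaryMeasure d₁ d₂ hε hphi hb⟩
  · filter_upwards [ae_eventually_summable_abs_wordProd hr, ae_contDiffAt_codingX d₁ d₂ hr,
      ae_iteratedDeriv_codingX_eq_formalX d₁ d₂ hl₁ hr] with ω hsum hsmooth hderiv
    refine ⟨(hshift.eventually hsum).mono fun ε hε =>
        (summable_norm_wordProd_mul_letter d₁ d₂ hε).of_norm, fun j hj =>
      ⟨(summable_nat_add_iff 1).2 (hderiv j hj).1,
        differentiableUpToAt_comp_const_add (hsmooth.of_le (mod_cast le_top)), (hderiv j hj).2⟩,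
      differentiableUpToAt_comp_const_add
        (hphi.contDiffAt.comp l₁ (hsmooth.of_le (mod_cast le_top)))⟩
  · have hint := integrable_iteratedDeriv_comp_codingX d₁ d₂ hr hphi hb hl
    have hformal := (ae_iteratedDeriv_comp_codingX_eq_formalDerivative d₁ d₂ hl₁ hr hphi).mono
      fun ω hω => hω l hl
    have hderiv := iteratedDeriv_integral_stationaryMeasure d₁ d₂ hr hphi hb hl
    exact ⟨hint, hint.congr hformal, hderiv, hderiv.trans (integral_congr_ae hformal)⟩

theorem mainTheorem2 (r : ℕ) (l₁ l₂ d₁ d₂ : ℝ) (hl₁ : 0 < l₁) (hl₁' : l₁ < 1) (hl₂ : 1 < l₂)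
    (hr : (l₁ ^ r + l₂ ^ r) / 2 < 1)
    (phi : ℝ → ℝ) (hphi : ContDiff ℝ (r : ℕ∞) phi) (hb : ∃ M : ℝ, ∀ x, |iteratedDeriv r phi x| ≤ M) :
    -- near `ε = 0` the stationary measure exists, is unique, and integrates `φ`
    (∀ᶠ ε in 𝓝 (0 : ℝ), (∃! μ : Measure ℝ, IsStationaryMeasure (l₁ + ε) l₂ d₁ d₂ μ) ∧
      Integrable phi (stationaryMeasure (l₁ + ε) l₂ d₁ d₂)) ∧
    -- for almost every word the series `X(ε)` converges for small `ε`; its derivatives at `0` are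
    -- the convergent series `X^{(j)}`; and `φ(X(ε))` is differentiable at `0` up to order `r`
    (∀ᵐ ω ∂bernoulliMeasure,
      (∀ᶠ ε in 𝓝 (0 : ℝ),
        Summable (fun m => wordProd (l₁ + ε) l₂ m ω * (![d₁, d₂] : Fin 2 → ℝ) (ω m))) ∧
      (∀ j : ℕ, 1 ≤ j →
        Summable (fun m => formalTerm l₁ l₂ d₁ d₂ j (m + 1) ω) ∧
        DifferentiableUpToAt j (fun ε => codingX (l₁ + ε) l₂ d₁ d₂ ω) 0 ∧
        iteratedDeriv j (fun ε => codingX (l₁ + ε) l₂ d₁ d₂ ω) 0 = formalX l₁ l₂ d₁ d₂ j ω) ∧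
      DifferentiableUpToAt r (fun ε => phi (codingX (l₁ + ε) l₂ d₁ d₂ ω)) 0) ∧
    -- `h(ε) = ∫ φ dμ_{l₁ + ε, l₂}` is differentiable at `0` up to order `r`
    DifferentiableUpToAt r (fun ε => ∫ x, phi x ∂(stationaryMeasure (l₁ + ε) l₂ d₁ d₂)) 0 ∧
    -- and its derivatives at `0` are given by both formulas
    ∀ l : ℕ, 1 ≤ l → l ≤ r →
      Integrable (fun ω => iteratedDeriv l (fun ε => phi (codingX (l₁ + ε) l₂ d₁ d₂ ω)) 0)
        bernoulliMeasure ∧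
      Integrable (fun ω => formalDerivative l₁ l₂ d₁ d₂ phi l ω) bernoulliMeasure ∧
      iteratedDeriv l (fun ε => ∫ x, phi x ∂(stationaryMeasure (l₁ + ε) l₂ d₁ d₂)) 0 =
        ∫ ω, iteratedDeriv l (fun ε => phi (codingX (l₁ + ε) l₂ d₁ d₂ ω)) 0 ∂bernoulliMeasure ∧
      iteratedDeriv l (fun ε => ∫ x, phi x ∂(stationaryMeasure (l₁ + ε) l₂ d₁ d₂)) 0 =
        ∫ ω, formalDerivative l₁ l₂ d₁ d₂ phi l ω ∂bernoulliMeasure :=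
  mainTheorem2_general r l₁ l₂ d₁ d₂ hl₁.ne'
    (by rwa [abs_of_pos hl₁, abs_of_pos (one_pos.trans hl₂)]) phi hphi hb
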